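/- Let $\kappa\in\mathbb{R}$ and let $(M_\kappa,d_\kappa)$ be the model plane of constant curvature $\kappa$: the Euclidean plane if $\kappa=0$, the unit sphere $S^2$ with its angular metric multiplied by $1/\sqrt{\kappa}$ if $\kappa>0$, and the hyperbolic plane of curvature $-1$ with its metric multiplied by $1/\sqrt{-\kappa}$ if $\kappa<0$. Call a triangle $(a_1,a_2,a_3)$ in a metric space $(X,d)$ (that is, a triple of points) *small* if $\kappa\le 0$, or if $\kappa>0$ and $d(a_1,a_2)+d(a_2,a_3)+d(a_3,a_1)<2\pi/\sqrt{\kappa}$. A *comparison triangle* for it is a triple $(\overline a_1,\overline a_2,\overline a_3)$ in $M_\kappa$ with $d_\kappa(\overline a_i,\overline a_j)=d(a_i,a_j)$ for all $i,j$. A metric space $(X,d)$ is a $\mathrm{CAT}(\kappa)$ space if any two points of $X$ (at distance less than $\pi/\sqrt{\kappa}$ if $\kappa>0$) are joined by a geodesic and, for every geodesic triangle in $X$ whose vertices form a small triangle, the distance between any two points on its sides is at most the distance between the corresponding points on the sides of a comparison triangle in $M_\kappa$. The *circumradius* of a triple in a metric space $(Y,d_Y)$ is $$r(a_1,a_2,a_3)=\inf_{y\in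 Y}\ \max_{i=1,2,3} d_Y(y,a_i).$$ We say that $\operatorname{Curv} X\le\kappa$ if $r(a_1,a_2,a_3)\le r(\overline a_1,\overline a_2,\overline a_3)$ for every small triangle $(a_1,a_2,a_3)$ in $X$ and every comparison triangle $(\overline a_1,\overline a_2,\overline a_3)$ for it in $M_\kappa$, where the left circumradius is taken in $X$ and the right one in $M_\kappa$. **Theorem.** Let $\kappa\in\mathbb{R}$ and let $(X,d)$ be a $\mathrm{CAT}(\kappa)$ space. Then $\operatorname{Curv} X\le\kappa$. -/

import Mathlib

noncomputable section

/-- The three simply connected surfaces of constant curvature `1`, `0`, `-1`: the unit sphere in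
`ℝ³`, the Euclidean plane, and the hyperbolic plane (upper half-plane model). -/
def UnitModelPlane : SignType → Type
  | .pos => Metric.sphere (0 : EuclideanSpace ℝ (Fin 3)) 1
  | .zero => EuclideanSpace ℝ (Fin 2)
  | .neg => UpperHalfPlane

/-- The intrinsic distance of the unit models: the angular distance on the sphere, the Euclidean
distance on the plane, the hyperbolic distance on the upper half-plane. -/
def UnitModelPlane.intrinsicDist : (s : SignType) → UnitModelPlane s → UnitModelPlane s → ℝ
  | .pos => fun (x y : Metric.sphere (0 : EuclideanSpace ℝ (Fin 3)) 1) =>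
      InnerProductGeometry.angle (x : EuclideanSpace ℝ (Fin 3)) (y : EuclideanSpace ℝ (Fin 3))
  | .zero => fun (x y : EuclideanSpace ℝ (Fin 2)) => dist x y
  | .neg => fun (x y : UpperHalfPlane) => dist x y

/-- The points of the model plane `M_κ` of constant curvature `κ`. -/
def ModelPlane (κ : ℝ) : Type := UnitModelPlane (SignType.sign κ)

/-- The factor by which the unit model is rescaled: `1 / √|κ|` for `κ ≠ 0`, and `1` for `κ = 0`. -/
def modelScale (κ : ℝ) : ℝ := if κ = 0 then 1 else 1 / √|κ|

theorem modelScale_pos (κ : ℝ) : 0 < modelScale κ := by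
  unfold modelScale
  split_ifs with h
  · exact one_pos
  · have := Real.sqrt_pos.mpr (abs_pos.mpr h)
    positivity

namespace UnitModelPlane

theorem intrinsicDist_self (s : SignType) (x : UnitModelPlane s) : intrinsicDist s x x = 0 := by
  cases s with
  | zero => exact dist_self (α := EuclideanSpace ℝ (Fin 2)) x
  | neg => exact dist_self (α := UpperHalfPlane) x
  | pos =>
    exact InnerProductGeometry.angle_self
      (ne_zero_of_mem_unit_sphere (x : Metric.sphere (0 : EuclideanSpace ℝ (Fin 3)) 1))

theorem intrinsicDist_comm (s : SignType) (x y : UnitModelPlane s) :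
    intrinsicDist s x y = intrinsicDist s y x := by
  cases s with
  | zero => exact dist_comm (α := EuclideanSpace ℝ (Fin 2)) x y
  | neg => exact dist_comm (α := UpperHalfPlane) x y
  | pos => exact InnerProductGeometry.angle_comm _ _

theorem intrinsicDist_triangle (s : SignType) (x y z : UnitModelPlane s) :
    intrinsicDist s x z ≤ intrinsicDist s x y + intrinsicDist s y z := by
  cases s with
  | zero => exact dist_triangle (α := EuclideanSpace ℝ (Fin 2)) x y z
  | neg => exact dist_triangle (α := UpperHalfPlane) x y z
  | pos => exact InnerProductGeometry.angle_le_angle_add_angle _ _ _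

theorem eq_of_intrinsicDist_eq_zero (s : SignType) (x y : UnitModelPlane s)
    (h : intrinsicDist s x y = 0) : x = y := by
  cases s with
  | zero => exact eq_of_dist_eq_zero (γ := EuclideanSpace ℝ (Fin 2)) h
  | neg => exact eq_of_dist_eq_zero (γ := UpperHalfPlane) h
  | pos =>
    obtain ⟨-, r, hr, hy⟩ := InnerProductGeometry.angle_eq_zero_iff.mp h
    have hx1 : ‖(x : Metric.sphere (0 : EuclideanSpace ℝ (Fin 3)) 1).1‖ = 1 :=
      norm_eq_of_mem_sphere (x : Metric.sphere (0 : EuclideanSpace ℝ (Fin 3)) 1)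
    have hy1 : ‖(y : Metric.sphere (0 : EuclideanSpace ℝ (Fin 3)) 1).1‖ = 1 :=
      norm_eq_of_mem_sphere (y : Metric.sphere (0 : EuclideanSpace ℝ (Fin 3)) 1)
    rw [hy, norm_smul, hx1, mul_one, Real.norm_of_nonneg hr.le] at hy1
    rw [hy1, one_smul] at hy
    exact Subtype.ext hy.symm

end UnitModelPlane

/-- The model plane `(M_κ, d_κ)` as a metric space: for `κ > 0` the unit sphere with the angular
metric multiplied by `1 / √κ`, for `κ = 0` the Euclidean plane, for `κ < 0` the hyperbolic plane
of curvature `-1` with the metric multiplied by `1 / √(-κ)`. -/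
instance ModelPlane.instMetricSpace (κ : ℝ) : MetricSpace (ModelPlane κ) where
  dist x y := modelScale κ * UnitModelPlane.intrinsicDist (SignType.sign κ) x y
  dist_self x :=
    mul_eq_zero_of_right _ (UnitModelPlane.intrinsicDist_self (SignType.sign κ) x)
  dist_comm x y :=
    congrArg (modelScale κ * ·) (UnitModelPlane.intrinsicDist_comm (SignType.sign κ) x y)
  dist_triangle x y z :=
    (mul_le_mul_of_nonneg_left (UnitModelPlane.intrinsicDist_triangle (SignType.sign κ) x y z)
      (modelScale_pos κ).le).trans_eq (mul_add _ _ _)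
  eq_of_dist_eq_zero {x y} h :=
    UnitModelPlane.eq_of_intrinsicDist_eq_zero (SignType.sign κ) x y
      ((mul_eq_zero.mp h).resolve_left (modelScale_pos κ).ne')

/-- `γ`, restricted to `[0, 1]`, is a (constant speed, minimizing) geodesic from `x` to `y`. -/
def IsGeodesic {X : Type*} [MetricSpace X] (γ : ℝ → X) (x y : X) : Prop :=
  γ 0 = x ∧ γ 1 = y ∧
    ∀ s ∈ Set.Icc (0 : ℝ) 1, ∀ t ∈ Set.Icc (0 : ℝ) 1, dist (γ s) (γ t) = dist x y * |s - t|

/-- A triangle is small relative to `κ` if `κ ≤ 0`, or if its perimeter is less than `2π / √κ`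
(twice the diameter of `M_κ`). -/
def IsSmallTriangle {X : Type*} [MetricSpace X] (κ : ℝ) (a : Fin 3 → X) : Prop :=
  0 < κ → dist (a 0) (a 1) + dist (a 1) (a 2) + dist (a 2) (a 0) < 2 * Real.pi / √κ

/-- `b` is a comparison triangle in `M_κ` for the triangle `a`. -/
def IsComparisonTriangle {X : Type*} [MetricSpace X] {κ : ℝ} (a : Fin 3 → X)
    (b : Fin 3 → ModelPlane κ) : Prop :=
  ∀ i j, dist (b i) (b j) = dist (a i) (a j)

/-- `x'` is a comparison point in `M_κ`, on a geodesic segment `[p', q']`, for the point `x` on a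
geodesic segment `[p, q]` (where `d_κ(p', q') = d(p, q)`): its distances to the end points are the
same as those of `x`. -/
def IsComparisonPoint {X : Type*} [MetricSpace X] {κ : ℝ} (p q x : X)
    (p' q' x' : ModelPlane κ) : Prop :=
  dist p' x' = dist p x ∧ dist x' q' = dist x q

/-- `X` is a `CAT(κ)` space: any two points (at distance less than `π / √κ` if `κ > 0`) are joined
by a geodesic, and every geodesic triangle (of perimeter less than `2π / √κ` if `κ > 0`), with
sides `γ i` from `a i` to `a (i + 1)`, indices modulo `3`, is not thicker than its comparison
triangle in `M_κ`: distances between points on its sides do not exceed the distances between the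
corresponding comparison points. -/
structure IsCAT (κ : ℝ) (X : Type*) [MetricSpace X] : Prop where
  exists_geodesic : ∀ x y : X, (0 < κ → dist x y < Real.pi / √κ) → ∃ γ : ℝ → X, IsGeodesic γ x y
  comparison : ∀ (a : Fin 3 → X) (γ : Fin 3 → ℝ → X),
    (∀ i, IsGeodesic (γ i) (a i) (a (i + 1))) → IsSmallTriangle κ a →
    ∀ b : Fin 3 → ModelPlane κ, IsComparisonTriangle a b →
    ∀ i j, ∀ s ∈ Set.Icc (0 : ℝ) 1, ∀ t ∈ Set.Icc (0 : ℝ) 1, ∀ x' y' : ModelPlane κ,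
      IsComparisonPoint (a i) (a (i + 1)) (γ i s) (b i) (b (i + 1)) x' →
      IsComparisonPoint (a j) (a (j + 1)) (γ j t) (b j) (b (j + 1)) y' →
      dist (γ i s) (γ j t) ≤ dist x' y'

/-- The circumradius `inf_x max_i d(x, a_i)` of a triangle. -/
def circumradius {X : Type*} [MetricSpace X] (a : Fin 3 → X) : ℝ :=
  ⨅ x : X, max (dist x (a 0)) (max (dist x (a 1)) (dist x (a 2)))

/-- `Curv X ≤ κ`: the circumradius of every triangle in `X` (of perimeter less than `2π / √κ` if
`κ > 0`) is at most the circumradius of its comparison triangles in `M_κ`. -/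
def CurvLE (X : Type*) [MetricSpace X] (κ : ℝ) : Prop :=
  ∀ a : Fin 3 → X, IsSmallTriangle κ a →
    ∀ b : Fin 3 → ModelPlane κ, IsComparisonTriangle a b → circumradius a ≤ circumradius b

end

noncomputable section

open Real Filter Topology

/-! It suffices to show: if a ball with centre o and radius R contains the comparison triangle, then
some y in X is within R of every vertex. Run along the side from `a 0` to `a 1`; for each point p of
it take a geodesic from `a 2` to p and stop at distance R, or at p if p is nearer. The stopping
points form a continuous curve (`IsCAT.continuous_geodesic`) inside the R-ball around `a 2`. Sides
are at most 2R, so the curve starts within R of `a 0` and ends within R of `a 1`. If each of its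
points is within R of `a 0` or of `a 1`, these two conditions define closed nonempty sets covering
an interval; by connectedness they meet, and a common parameter gives y.

The covering (`IsCAT.unitDist_le_or_unitDist_le`) is clear where the curve lies on the side.
Elsewhere let p' correspond to p on the comparison side. The CAT condition gives d(a₂, p) ≤ d(b₂,
p'), and d(o, p') ≥ d(b₂, p') - R. With C = `modelCos`, a decreasing function of distance, C of the
distance to a moving point of a segment is, in the model plane, an explicit weighted combination of
its values at the ends (`UnitModelPlane.exists_lineMap`); in X this becomes an inequality
(`IsCAT.modelCos_interpolate_le`). Hence, with the weights of p on its side, the average of C(d(y,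
a₀)) and C(d(y, a₁)) is at least that of C(d(o, b₀)) and C(d(o, b₁)), so both distances from y
cannot exceed R. The functions `modelSin`, `modelCos` and `modelDefect` let one computation serve
all signs of κ. -/

/-! ### Generalized trigonometry -/

/-- The generalized sine of the model plane of curvature `1`, `0`, `-1`. -/
def modelSin : SignType → ℝ → ℝ
  | .pos => Real.sin
  | .zero => fun x => x
  | .neg => Real.sinh

/-- A strictly decreasing function of the distance which behaves affinely along geodesics of the
model plane of curvature `1`, `0`, `-1`, up to the correction `modelDefect`. -/
def modelCos : SignType → ℝ → ℝ
  | .pos => Real.cos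
  | .zero => fun x => -(x ^ 2) / 2
  | .neg => fun x => -Real.cosh x

/-- The inhomogeneous term in the interpolation formula for `modelCos`. -/
def modelDefect : SignType → ℝ → ℝ → ℝ
  | .pos => fun _ _ => 0
  | .zero => fun l t => t * (1 - t) * l ^ 3 / 2
  | .neg => fun _ _ => 0

/-- The distances which occur in the model plane of curvature `1`, `0`, `-1`. -/
def modelRange (s : SignType) : Set ℝ := {x | 0 ≤ x ∧ (s = .pos → x ≤ π)}

theorem continuous_modelSin (s : SignType) : Continuous (modelSin s) := by
  cases s <;> simp only [modelSin] <;> fun_prop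

theorem continuous_modelCos (s : SignType) : Continuous (modelCos s) := by
  cases s <;> simp only [modelCos] <;> fun_prop

theorem continuous_modelDefect (s : SignType) :
    Continuous fun x : ℝ × ℝ => modelDefect s x.1 x.2 := by
  cases s <;> simp only [modelDefect] <;> fun_prop

theorem modelSin_zero (s : SignType) : modelSin s 0 = 0 := by
  cases s <;> simp [modelSin]

theorem modelSin_pos {s : SignType} {x : ℝ} (hx : 0 < x) (h : s = .pos → x < π) :
    0 < modelSin s x := by
  cases s with
  | zero => exact hx
  | neg => exact Real.sinh_pos_iff.mpr hx
  | pos => exact Real.sin_pos_of_pos_of_lt_pi hx (h rfl)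

theorem modelSin_nonneg {s : SignType} {x : ℝ} (hx : x ∈ modelRange s) : 0 ≤ modelSin s x := by
  cases s with
  | zero => exact hx.1
  | neg => exact Real.sinh_nonneg_iff.mpr hx.1
  | pos => exact Real.sin_nonneg_of_nonneg_of_le_pi hx.1 (hx.2 rfl)

theorem modelCos_strictAntiOn (s : SignType) : StrictAntiOn (modelCos s) (modelRange s) := by
  intro x hx y hy hxy
  have hx0 := hx.1
  cases s with
  | zero =>
    change -(y ^ 2) / 2 < -(x ^ 2) / 2
    nlinarith
  | neg =>
    change -Real.cosh y < -Real.cosh x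
    rw [neg_lt_neg_iff, Real.cosh_lt_cosh, abs_of_nonneg hx.1, abs_of_nonneg hy.1]
    exact hxy
  | pos => exact Real.cos_lt_cos_of_nonneg_of_le_pi hx0 (hy.2 rfl) hxy

theorem modelCos_le_iff {s : SignType} {x y : ℝ} (hx : x ∈ modelRange s) (hy : y ∈ modelRange s) :
    modelCos s x ≤ modelCos s y ↔ y ≤ x :=
  (modelCos_strictAntiOn s).le_iff_ge hx hy

theorem modelCos_inj {s : SignType} {x y : ℝ} (hx : x ∈ modelRange s) (hy : y ∈ modelRange s)
    (h : modelCos s x = modelCos s y) : x = y :=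
  (modelCos_strictAntiOn s).injOn hx hy h

/-- The addition formula for sin or sinh: this is the interpolation formula evaluated at the
dividing point itself. The next lemmas evaluate it at the two ends. -/
theorem modelCos_interpolate_self (s : SignType) (l t : ℝ) :
    modelSin s ((1 - t) * l) * modelCos s (t * l) + modelSin s (t * l) * modelCos s ((1 - t) * l) +
      modelDefect s l t = modelSin s l * modelCos s 0 := by
  cases s with
  | zero => simp only [modelSin, modelCos, modelDefect]; ring
  | neg =>
    simp only [modelSin, modelCos, modelDefect]
    have := Real.sinh_add ((1 - t) * l) (t * l)
    rw [show (1 - t) * l + t * l = l by ring] at this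
    rw [this, Real.cosh_zero]; ring
  | pos =>
    simp only [modelSin, modelCos, modelDefect]
    have := Real.sin_add ((1 - t) * l) (t * l)
    rw [show (1 - t) * l + t * l = l by ring] at this
    rw [this, Real.cos_zero]; ring

theorem modelCos_interpolate_left (s : SignType) (l t : ℝ) :
    modelSin s ((1 - t) * l) * modelCos s 0 + modelSin s (t * l) * modelCos s l +
      modelDefect s l t = modelSin s l * modelCos s (t * l) := by
  cases s with
  | zero => simp only [modelSin, modelCos, modelDefect]; ring
  | neg =>
    simp only [modelSin, modelCos, modelDefect]
    rw [show (1 - t) * l = l - t * l by ring, Real.sinh_sub, Real.cosh_zero]; ring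
  | pos =>
    simp only [modelSin, modelCos, modelDefect]
    rw [show (1 - t) * l = l - t * l by ring, Real.sin_sub, Real.cos_zero]; ring

theorem modelDefect_symm (s : SignType) (l t : ℝ) :
    modelDefect s l (1 - t) = modelDefect s l t := by
  cases s <;> simp only [modelDefect]
  ring

theorem modelCos_interpolate_right (s : SignType) (l t : ℝ) :
    modelSin s ((1 - t) * l) * modelCos s l + modelSin s (t * l) * modelCos s 0 +
      modelDefect s l t = modelSin s l * modelCos s ((1 - t) * l) := by
  have := modelCos_interpolate_left s l (1 - t)
  rw [modelDefect_symm, sub_sub_cancel] at this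
  rw [← this]; ring

/-- The quantity compared along a segment of length `l`, when the distance from its end point to
the opposite vertex is replaced by `L`. -/
theorem modelCos_sub_le (s : SignType) {l t L : ℝ} (h : t * l ∈ modelRange s) :
    modelSin s l * modelCos s (L - t * l) ≤
      modelSin s ((1 - t) * l) * modelCos s L + modelSin s (t * l) * modelCos s 0 +
      modelDefect s l t := by
  -- In all three geometries the right side minus the left is `modelSin s (t * l)` times `modelCos s
  -- 0 - modelCos s (L - l)`, which is nonnegative.
  have h0 := modelSin_nonneg h
  cases s with
  | zero =>
    simp only [modelSin, modelCos, modelDefect] at *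
    nlinarith [mul_nonneg h0 (sq_nonneg (L - l))]
  | neg =>
    simp only [modelSin, modelCos, modelDefect] at *
    have h1 := Real.one_le_cosh (L - l)
    have h2 : Real.sinh l * Real.cosh (L - t * l) - Real.sinh ((1 - t) * l) * Real.cosh L
        = Real.sinh (t * l) * Real.cosh (L - l) := by
      rw [show (1 - t) * l = l - t * l by ring, Real.sinh_sub, Real.cosh_sub, Real.cosh_sub]
      ring
    rw [Real.cosh_zero]
    nlinarith
  | pos =>
    simp only [modelSin, modelCos, modelDefect] at *
    have h1 := Real.cos_le_one (L - l)
    have h2 : Real.sin l * Real.cos (L - t * l) - Real.sin ((1 - t) * l) * Real.cos L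
        = Real.sin (t * l) * Real.cos (L - l) := by
      rw [show (1 - t) * l = l - t * l by ring, Real.sin_sub, Real.cos_sub, Real.cos_sub]
      ring
    rw [Real.cos_zero]
    nlinarith

/-- Only the flat case has a defect, and there the two weights add up to l. This lets the defects
cancel when two interpolations are nested. -/
theorem modelDefect_mul (s : SignType) (l t l' t' : ℝ) :
    (modelSin s ((1 - t) * l) + modelSin s (t * l)) * modelDefect s l' t' =
      modelSin s l * modelDefect s l' t' := by
  cases s <;> simp only [modelDefect, modelSin, mul_zero]
  ring

/-! ### Points on segments of the model planes -/

namespace UnitModelPlane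

theorem intrinsicDist_mem_modelRange {s : SignType} (x y : UnitModelPlane s) :
    intrinsicDist s x y ∈ modelRange s := by
  cases s with
  | zero => exact ⟨dist_nonneg (α := EuclideanSpace ℝ (Fin 2)), fun h => by cases h⟩
  | neg => exact ⟨dist_nonneg (α := UpperHalfPlane), fun h => by cases h⟩
  | pos => exact ⟨InnerProductGeometry.angle_nonneg _ _, fun _ => InnerProductGeometry.angle_le_pi _ _⟩

end UnitModelPlane

/-- The cosine of the angle is the inner product, linear in the point, so the spherical
interpolation of x and y works once it is known to be a unit vector. -/
theorem exists_lineMap_sphere (x y : Metric.sphere (0 : EuclideanSpace ℝ (Fin 3)) 1) (t : ℝ)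
    (hxy : 0 < Real.sin (InnerProductGeometry.angle x.1 y.1)) :
    ∃ p : Metric.sphere (0 : EuclideanSpace ℝ (Fin 3)) 1,
      ∀ z : Metric.sphere (0 : EuclideanSpace ℝ (Fin 3)) 1,
      Real.sin (InnerProductGeometry.angle x.1 y.1) * Real.cos (InnerProductGeometry.angle z.1 p.1) =
        Real.sin ((1 - t) * InnerProductGeometry.angle x.1 y.1) *
            Real.cos (InnerProductGeometry.angle z.1 x.1) +
          Real.sin (t * InnerProductGeometry.angle x.1 y.1) *
            Real.cos (InnerProductGeometry.angle z.1 y.1) := by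
  have hn : ∀ z : Metric.sphere (0 : EuclideanSpace ℝ (Fin 3)) 1, ‖z.1‖ = 1 := fun z =>
    norm_eq_of_mem_sphere z
  have hcos : ∀ z w : Metric.sphere (0 : EuclideanSpace ℝ (Fin 3)) 1,
      Real.cos (InnerProductGeometry.angle z.1 w.1) = inner ℝ z.1 w.1 := fun z w => by
    rw [InnerProductGeometry.cos_angle, hn, hn]; simp
  set l := InnerProductGeometry.angle x.1 y.1
  set P : EuclideanSpace ℝ (Fin 3) :=
    (Real.sin l)⁻¹ • (Real.sin ((1 - t) * l) • x.1 + Real.sin (t * l) • y.1) with hP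
  have key : Real.sin ((1 - t) * l) ^ 2 + Real.sin (t * l) ^ 2 +
      2 * Real.sin ((1 - t) * l) * Real.sin (t * l) * Real.cos l = Real.sin l ^ 2 := by
    rw [show (1 - t) * l = l - t * l by ring, Real.sin_sub]
    have h1 := Real.sin_sq_add_cos_sq l
    have h2 := Real.sin_sq_add_cos_sq (t * l)
    linear_combination (Real.sin l ^ 2) * h2 + (-Real.sin (t * l) ^ 2) * h1
  have hPn : ‖P‖ = 1 := by
    have h1 : ‖Real.sin ((1 - t) * l) • x.1 + Real.sin (t * l) • y.1‖ ^ 2 = Real.sin l ^ 2 := by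
      rw [norm_add_sq_real, norm_smul, norm_smul, hn, hn, inner_smul_left, inner_smul_right,
        ← hcos, ← key]
      simp only [Real.norm_eq_abs, mul_one, sq_abs, conj_trivial]
      ring
    have h2 := (pow_left_inj₀ (norm_nonneg _) hxy.le two_ne_zero).mp h1
    rw [hP, norm_smul, h2, norm_inv, Real.norm_of_nonneg hxy.le, inv_mul_cancel₀ hxy.ne']
  refine ⟨⟨P, by simpa using hPn⟩, fun z => ?_⟩
  rw [hcos, hcos, hcos]
  simp only [hP, inner_smul_right, inner_add_right]
  rw [mul_inv_cancel_left₀ hxy.ne']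

theorem exists_lineMap_euclidean (x y : EuclideanSpace ℝ (Fin 2)) (t : ℝ) :
    ∃ p : EuclideanSpace ℝ (Fin 2), ∀ z : EuclideanSpace ℝ (Fin 2),
      dist z p ^ 2 = (1 - t) * dist z x ^ 2 + t * dist z y ^ 2 - t * (1 - t) * dist x y ^ 2 := by
  refine ⟨(1 - t) • x + t • y, fun z => ?_⟩
  have h1 : z - ((1 - t) • x + t • y) = (1 - t) • (z - x) + t • (z - y) := by module
  have h2 : x - y = (z - y) - (z - x) := by abel
  rw [dist_eq_norm, dist_eq_norm, dist_eq_norm, dist_eq_norm, h1, h2, norm_add_sq_real,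
    norm_sub_sq_real (z - y), norm_smul, norm_smul, inner_smul_left, inner_smul_right,
    real_inner_comm (z - x)]
  simp only [mul_pow, Real.norm_eq_abs, sq_abs, conj_trivial]
  ring

/-- Points correspond to positive definite symmetric matrices with rows (a, b), (b, c) and
determinant 1. In these coordinates the hyperbolic cosine of the distance is linear, as on the
hyperboloid. -/
theorem UpperHalfPlane.exists_of_det_eq_one {a b c : ℝ} (hc : 0 < c) (h : a * c - b ^ 2 = 1) :
    ∃ p : UpperHalfPlane, ∀ z : UpperHalfPlane,
      Real.cosh (dist z p) = (a + (z.re ^ 2 + z.im ^ 2) * c - 2 * z.re * b) / (2 * z.im) := by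
  refine ⟨⟨⟨b / c, 1 / c⟩, by simpa using hc⟩, fun z => ?_⟩
  have hz := z.im_pos
  rw [UpperHalfPlane.cosh_dist, Complex.dist_eq, Complex.sq_norm, Complex.normSq_apply]
  simp only [Complex.sub_re, Complex.sub_im]
  change 1 + ((z.re - b / c) * (z.re - b / c) + (z.im - 1 / c) * (z.im - 1 / c)) /
    (2 * z.im * (1 / c)) = _
  field_simp
  linear_combination -h

theorem exists_lineMap_upperHalfPlane (x y : UpperHalfPlane) {t : ℝ} (ht : t ∈ Set.Icc (0 : ℝ) 1)
    (hxy : 0 < dist x y) :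
    ∃ p : UpperHalfPlane, ∀ z : UpperHalfPlane,
      Real.sinh (dist x y) * Real.cosh (dist z p) =
        Real.sinh ((1 - t) * dist x y) * Real.cosh (dist z x) +
          Real.sinh (t * dist x y) * Real.cosh (dist z y) := by
  have hcosh : ∀ z w : UpperHalfPlane, Real.cosh (dist z w) =
      (z.re ^ 2 + z.im ^ 2 + w.re ^ 2 + w.im ^ 2 - 2 * z.re * w.re) / (2 * z.im * w.im) := by
    intro z w
    have hz := z.im_pos
    have hw := w.im_pos
    rw [UpperHalfPlane.cosh_dist, Complex.dist_eq, Complex.sq_norm, Complex.normSq_apply]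
    simp only [Complex.sub_re, Complex.sub_im, UpperHalfPlane.coe_re, UpperHalfPlane.coe_im]
    field_simp
    ring
  have hc := hcosh x y
  set l := dist x y
  have hx := x.im_pos
  have hy := y.im_pos
  have hs : 0 < Real.sinh l := Real.sinh_pos_iff.mpr hxy
  have hA : 0 ≤ Real.sinh ((1 - t) * l) :=
    Real.sinh_nonneg_iff.mpr (mul_nonneg (by linarith [ht.2]) hxy.le)
  have hB : 0 ≤ Real.sinh (t * l) := Real.sinh_nonneg_iff.mpr (mul_nonneg ht.1 hxy.le)
  have key : Real.sinh ((1 - t) * l) ^ 2 + Real.sinh (t * l) ^ 2 +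
      2 * Real.sinh ((1 - t) * l) * Real.sinh (t * l) * Real.cosh l = Real.sinh l ^ 2 := by
    rw [show (1 - t) * l = l - t * l by ring, Real.sinh_sub]
    have h1 := Real.cosh_sq l
    have h2 := Real.cosh_sq (t * l)
    linear_combination (Real.sinh l ^ 2) * h2 + (-Real.sinh (t * l) ^ 2) * h1
  set A := Real.sinh ((1 - t) * l)
  set B := Real.sinh (t * l)
  set S := Real.sinh l
  -- If both weights vanished, `key` would force `S = 0`.
  have hAB : 0 < A / x.im + B / y.im := by
    rcases hA.eq_or_lt with hA' | hA'
    · rcases hB.eq_or_lt with hB' | hB'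
      · rw [← hA', ← hB'] at key; nlinarith
      · positivity
    · positivity
  obtain ⟨p, hp⟩ := UpperHalfPlane.exists_of_det_eq_one
    (a := (A * ((x.re ^ 2 + x.im ^ 2) / x.im) + B * ((y.re ^ 2 + y.im ^ 2) / y.im)) / S)
    (b := (A * (x.re / x.im) + B * (y.re / y.im)) / S) (c := (A / x.im + B / y.im) / S)
    (by positivity) (by
      rw [hc] at key
      field_simp
      field_simp at key
      linear_combination (x.im * y.im) * key)
  refine ⟨p, fun z => ?_⟩
  have hz := z.im_pos
  rw [hp, hcosh z x, hcosh z y]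
  field_simp
  ring

/-- Points on segments of the model plane, and their distances to all other points. -/
theorem UnitModelPlane.exists_lineMap {s : SignType} (x y : UnitModelPlane s) {t : ℝ}
    (ht : t ∈ Set.Icc (0 : ℝ) 1) (h0 : 0 < intrinsicDist s x y)
    (hπ : s = .pos → intrinsicDist s x y < π) :
    ∃ p : UnitModelPlane s, ∀ z : UnitModelPlane s,
      modelSin s (intrinsicDist s x y) * modelCos s (intrinsicDist s z p) =
        modelSin s ((1 - t) * intrinsicDist s x y) * modelCos s (intrinsicDist s z x) +
          modelSin s (t * intrinsicDist s x y) * modelCos s (intrinsicDist s z y) +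
          modelDefect s (intrinsicDist s x y) t := by
  have hs := modelSin_pos h0 hπ
  cases s with
  | zero =>
    obtain ⟨p, hp⟩ := exists_lineMap_euclidean x y t
    refine ⟨p, fun z => ?_⟩
    have h := hp z
    simp only [modelSin, modelCos, modelDefect, intrinsicDist]
    rw [h]; ring
  | neg =>
    obtain ⟨p, hp⟩ := exists_lineMap_upperHalfPlane x y ht h0
    refine ⟨p, fun z => ?_⟩
    have h := hp z
    simp only [modelSin, modelCos, modelDefect, intrinsicDist]
    linear_combination -h
  | pos =>
    obtain ⟨p, hp⟩ := exists_lineMap_sphere x y t hs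
    refine ⟨p, fun z => ?_⟩
    have h := hp z
    simp only [modelSin, modelCos, modelDefect, intrinsicDist]
    rw [h, add_zero]

/-! ### Triangles with prescribed sides -/

/-- This places the third vertex: the law of cosines prescribes `S * x`, the triangle inequalities
bound it by `S * a`, and y is the remaining coordinate. If the first side degenerates, `S = 0` and x
is free. -/
theorem exists_sq_add_sq_eq {S a u v : ℝ} (h1 : -(S * a) ≤ u) (h2 : u ≤ S * a)
    (hS : S = 0 → u = 0) (hS0 : 0 ≤ S) (hv : v = a ^ 2) :
    ∃ x y : ℝ, S * x = u ∧ x ^ 2 + y ^ 2 = v := by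
  subst hv
  rcases hS0.eq_or_lt with h | h
  · exact ⟨0, a, by simp [hS h.symm], by ring⟩
  · have h3 : |u / S| ≤ a := by
      rw [abs_le, le_div_iff₀ h, div_le_iff₀ h]
      constructor <;> linarith
    have h4 : (u / S) ^ 2 ≤ a ^ 2 := by
      rw [← sq_abs]; exact pow_le_pow_left₀ (abs_nonneg _) h3 2
    exact ⟨u / S, √(a ^ 2 - (u / S) ^ 2), mul_div_cancel₀ _ h.ne', by
      rw [Real.sq_sqrt (by linarith)]; ring⟩

theorem exists_triangle_euclidean {α β γ : ℝ} (hα : 0 ≤ α) (hβ : 0 ≤ β) (hγ : 0 ≤ γ)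
    (h1 : α ≤ β + γ) (h2 : β ≤ γ + α) (h3 : γ ≤ α + β) :
    ∃ p q r : EuclideanSpace ℝ (Fin 2),
      dist p q ^ 2 = α ^ 2 ∧ dist q r ^ 2 = β ^ 2 ∧ dist r p ^ 2 = γ ^ 2 := by
  obtain ⟨x, y, hx, hxy⟩ := exists_sq_add_sq_eq (S := 2 * α) (a := γ)
    (u := α ^ 2 + γ ^ 2 - β ^ 2) (v := γ ^ 2) (by nlinarith) (by nlinarith)
    (fun h => by
      have h0 : α = 0 := by linarith
      have : β = γ := by linarith
      rw [h0, this]; ring) (by linarith) rfl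
  refine ⟨!₂[0, 0], !₂[α, 0], !₂[x, y], ?_, ?_, ?_⟩ <;>
  · rw [EuclideanSpace.dist_eq, Real.sq_sqrt (by positivity)]
    simp [Fin.sum_univ_two, Real.dist_eq]
    try linarith

theorem exists_triangle_sphere {α β γ : ℝ} (hα : 0 ≤ α) (hβ : 0 ≤ β) (hγ : 0 ≤ γ)
    (h1 : α ≤ β + γ) (h2 : β ≤ γ + α) (h3 : γ ≤ α + β) (h4 : α + β + γ < 2 * π) :
    ∃ p q r : Metric.sphere (0 : EuclideanSpace ℝ (Fin 3)) 1,
      Real.cos (InnerProductGeometry.angle p.1 q.1) = Real.cos α ∧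
      Real.cos (InnerProductGeometry.angle q.1 r.1) = Real.cos β ∧
      Real.cos (InnerProductGeometry.angle r.1 p.1) = Real.cos γ := by
  have hcos : ∀ z w : Metric.sphere (0 : EuclideanSpace ℝ (Fin 3)) 1,
      Real.cos (InnerProductGeometry.angle z.1 w.1) = inner ℝ z.1 w.1 := fun z w => by
    rw [InnerProductGeometry.cos_angle, norm_eq_of_mem_sphere z, norm_eq_of_mem_sphere w]; simp
  have hS : 0 ≤ Real.sin α := Real.sin_nonneg_of_nonneg_of_le_pi hα (by linarith)
  have ha : 0 ≤ Real.sin γ := Real.sin_nonneg_of_nonneg_of_le_pi hγ (by linarith)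
  have hsub : Real.cos β ≤ Real.cos (α - γ) := by
    rw [← Real.cos_abs (α - γ)]
    exact Real.cos_le_cos_of_nonneg_of_le_pi (abs_nonneg _) (by linarith)
      (abs_le.mpr ⟨by linarith, by linarith⟩)
  have hadd : Real.cos (α + γ) ≤ Real.cos β := by
    rcases le_total (α + γ) π with h | h
    · exact Real.cos_le_cos_of_nonneg_of_le_pi hβ h (by linarith)
    -- Beyond π the perimeter bound takes over: β is less than 2π - (α + γ).
    · rw [← Real.cos_two_pi_sub (α + γ)]
      exact Real.cos_le_cos_of_nonneg_of_le_pi hβ (by linarith) (by linarith)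
  rw [Real.cos_sub] at hsub
  rw [Real.cos_add] at hadd
  obtain ⟨x, y, hx, hxy⟩ := exists_sq_add_sq_eq (S := Real.sin α) (a := Real.sin γ)
    (u := Real.cos β - Real.cos α * Real.cos γ) (v := Real.sin γ ^ 2) (by linarith) (by linarith)
    (fun h => by rw [h] at hsub hadd; linarith) hS rfl
  have hα1 := Real.sin_sq_add_cos_sq α
  have hγ1 := Real.sin_sq_add_cos_sq γ
  have hmem : ∀ a b c : ℝ, a ^ 2 + b ^ 2 + c ^ 2 = 1 →
      !₂[a, b, c] ∈ Metric.sphere (0 : EuclideanSpace ℝ (Fin 3)) 1 := fun a b c h => by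
    rw [mem_sphere_zero_iff_norm, EuclideanSpace.norm_eq]
    simp [Fin.sum_univ_three, h]
  refine ⟨⟨!₂[1, 0, 0], hmem _ _ _ (by ring)⟩,
    ⟨!₂[Real.cos α, Real.sin α, 0], hmem _ _ _ (by linarith)⟩,
    ⟨!₂[Real.cos γ, x, y], hmem _ _ _ (by linarith)⟩, ?_, ?_, ?_⟩ <;> rw [hcos] <;>
    simp [PiLp.inner_apply, Fin.sum_univ_three]
  linarith

theorem exists_triangle_upperHalfPlane {α β γ : ℝ} (hα : 0 ≤ α) (hβ : 0 ≤ β) (hγ : 0 ≤ γ)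
    (h1 : α ≤ β + γ) (h2 : β ≤ γ + α) (h3 : γ ≤ α + β) :
    ∃ p q r : UpperHalfPlane,
      Real.cosh (dist p q) = Real.cosh α ∧ Real.cosh (dist q r) = Real.cosh β ∧
      Real.cosh (dist r p) = Real.cosh γ := by
  have hS : 0 ≤ Real.sinh α := Real.sinh_nonneg_iff.mpr hα
  have ha : 0 ≤ Real.sinh γ := Real.sinh_nonneg_iff.mpr hγ
  have hsub : Real.cosh (α - γ) ≤ Real.cosh β := by
    rw [Real.cosh_le_cosh, abs_of_nonneg hβ]
    exact abs_le.mpr ⟨by linarith, by linarith⟩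
  have hadd : Real.cosh β ≤ Real.cosh (α + γ) := by
    rw [Real.cosh_le_cosh, abs_of_nonneg hβ, abs_of_nonneg (by linarith)]
    linarith
  rw [Real.cosh_sub] at hsub
  rw [Real.cosh_add] at hadd
  obtain ⟨w, b, hw, hwb⟩ := exists_sq_add_sq_eq (S := Real.sinh α) (a := Real.sinh γ)
    (u := Real.cosh α * Real.cosh γ - Real.cosh β) (v := Real.sinh γ ^ 2) (by linarith)
    (by linarith) (fun h => by rw [h] at hsub hadd; linarith) hS rfl
  have hγ1 := Real.cosh_sq γ
  have hwγ : w < Real.cosh γ := by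
    have := Real.cosh_pos γ
    nlinarith [sq_nonneg b]
  -- The base point i is the identity matrix, so half the trace, here cosh γ, is the hyperbolic
  -- cosine of the distance from i to r.
  obtain ⟨r, hr⟩ := UpperHalfPlane.exists_of_det_eq_one (a := Real.cosh γ + w) (b := b)
    (c := Real.cosh γ - w) (by linarith) (by linear_combination hγ1 - hwb)
  obtain ⟨q, hq⟩ := UpperHalfPlane.exists_of_det_eq_one (a := Real.exp α) (b := 0)
    (c := Real.exp (-α)) (Real.exp_pos _) (by rw [← Real.exp_add]; simp)
  have hi : UpperHalfPlane.I.re = 0 ∧ UpperHalfPlane.I.im = 1 := by simp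
  refine ⟨UpperHalfPlane.I, ⟨⟨0, Real.exp α⟩, Real.exp_pos _⟩, r, ?_, ?_, ?_⟩
  · rw [UpperHalfPlane.cosh_dist, Complex.dist_eq, Complex.sq_norm, Complex.normSq_apply]
    simp [UpperHalfPlane.im, Real.cosh_eq, Real.exp_neg]
    field_simp
    ring
  · rw [hr]
    change (Real.cosh γ + w + (0 ^ 2 + Real.exp α ^ 2) * (Real.cosh γ - w) - 2 * 0 * b) /
      (2 * Real.exp α) = _
    have h : Real.cosh β = Real.cosh α * Real.cosh γ - Real.sinh α * w := by linarith
    rw [h, Real.cosh_eq α, Real.sinh_eq α, Real.exp_neg]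
    field_simp
    ring
  · rw [dist_comm, hr, hi.1, hi.2]
    ring

/-- Triangles with prescribed side lengths exist in the model planes. -/
theorem UnitModelPlane.exists_triangle (s : SignType) {α β γ : ℝ} (hα : 0 ≤ α) (hβ : 0 ≤ β)
    (hγ : 0 ≤ γ) (h1 : α ≤ β + γ) (h2 : β ≤ γ + α) (h3 : γ ≤ α + β)
    (h4 : s = .pos → α + β + γ < 2 * π) :
    ∃ p q r : UnitModelPlane s,
      intrinsicDist s p q = α ∧ intrinsicDist s q r = β ∧ intrinsicDist s r p = γ := by
  have key : ∃ p q r : UnitModelPlane s,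
      modelCos s (intrinsicDist s p q) = modelCos s α ∧
      modelCos s (intrinsicDist s q r) = modelCos s β ∧
      modelCos s (intrinsicDist s r p) = modelCos s γ := by
    cases s with
    | zero =>
      obtain ⟨p, q, r, hp, hq, hr⟩ := exists_triangle_euclidean hα hβ hγ h1 h2 h3
      refine ⟨p, q, r, ?_⟩
      simp only [modelCos, intrinsicDist]
      rw [hp, hq, hr]
      exact ⟨rfl, rfl, rfl⟩
    | neg =>
      obtain ⟨p, q, r, hp, hq, hr⟩ := exists_triangle_upperHalfPlane hα hβ hγ h1 h2 h3
      refine ⟨p, q, r, ?_⟩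
      simp only [modelCos, intrinsicDist]
      rw [hp, hq, hr]
      exact ⟨rfl, rfl, rfl⟩
    | pos => exact exists_triangle_sphere hα hβ hγ h1 h2 h3 (h4 rfl)
  obtain ⟨p, q, r, hp, hq, hr⟩ := key
  exact ⟨p, q, r,
    modelCos_inj (intrinsicDist_mem_modelRange _ _)
      ⟨hα, fun h => by have := h4 h; linarith⟩ hp,
    modelCos_inj (intrinsicDist_mem_modelRange _ _)
      ⟨hβ, fun h => by have := h4 h; linarith⟩ hq,
    modelCos_inj (intrinsicDist_mem_modelRange _ _)
      ⟨hγ, fun h => by have := h4 h; linarith⟩ hr⟩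

/-! ### Rescaled distances and geodesics -/

/-- The distance in the units for which the model plane has curvature `1`, `0` or `-1`. -/
def unitDist (κ : ℝ) {X : Type*} [MetricSpace X] (x y : X) : ℝ := dist x y / modelScale κ

section unitDist

variable {κ : ℝ} {X : Type*} [MetricSpace X]

theorem unitDist_nonneg (x y : X) : 0 ≤ unitDist κ x y :=
  div_nonneg dist_nonneg (modelScale_pos κ).le

theorem unitDist_self (x : X) : unitDist κ x x = 0 := by simp [unitDist]

theorem unitDist_comm (x y : X) : unitDist κ x y = unitDist κ y x := by
  rw [unitDist, unitDist, dist_comm]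

theorem unitDist_triangle (x y z : X) : unitDist κ x z ≤ unitDist κ x y + unitDist κ y z := by
  rw [unitDist, unitDist, unitDist, ← add_div]
  exact div_le_div_of_nonneg_right (dist_triangle x y z) (modelScale_pos κ).le

theorem eq_of_unitDist_eq_zero {x y : X} (h : unitDist κ x y = 0) : x = y :=
  dist_eq_zero.mp ((div_eq_zero_iff.mp h).resolve_right (modelScale_pos κ).ne')

theorem unitDist_le_unitDist_iff {Y : Type*} [MetricSpace Y] {x y : X} {z w : Y} :
    unitDist κ x y ≤ unitDist κ z w ↔ dist x y ≤ dist z w :=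
  div_le_div_iff_of_pos_right (modelScale_pos κ)

theorem unitDist_eq_unitDist_iff {Y : Type*} [MetricSpace Y] {x y : X} {z w : Y} :
    unitDist κ x y = unitDist κ z w ↔ dist x y = dist z w :=
  div_left_inj' (modelScale_pos κ).ne'

theorem continuous_unitDist : Continuous fun x : X × X => unitDist κ x.1 x.2 :=
  continuous_dist.div_const _

theorem ModelPlane.unitDist_eq (x y : ModelPlane κ) :
    unitDist κ x y = UnitModelPlane.intrinsicDist (SignType.sign κ) x y :=
  mul_div_cancel_left₀ _ (modelScale_pos κ).ne'

theorem ModelPlane.unitDist_mem_modelRange (x y : ModelPlane κ) :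
    unitDist κ x y ∈ modelRange (SignType.sign κ) :=
  unitDist_eq x y ▸ UnitModelPlane.intrinsicDist_mem_modelRange _ _

theorem sign_eq_pos_iff : SignType.sign κ = .pos ↔ 0 < κ := sign_eq_one_iff

theorem div_modelScale_lt_iff {x c : ℝ} (h : 0 < κ) : x / modelScale κ < c ↔ x < c / √κ := by
  rw [div_lt_iff₀ (modelScale_pos κ), modelScale, if_neg h.ne', abs_of_pos h, mul_one_div]

theorem IsGeodesic.unitDist_eq {γ : ℝ → X} {x y : X} (h : IsGeodesic γ x y) {s t : ℝ}
    (hs : s ∈ Set.Icc (0 : ℝ) 1) (ht : t ∈ Set.Icc (0 : ℝ) 1) :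
    unitDist κ (γ s) (γ t) = unitDist κ x y * |s - t| := by
  rw [unitDist, h.2.2 s hs t ht, unitDist, div_mul_eq_mul_div]

theorem IsGeodesic.unitDist_left {γ : ℝ → X} {x y : X} (h : IsGeodesic γ x y) {t : ℝ}
    (ht : t ∈ Set.Icc (0 : ℝ) 1) : unitDist κ x (γ t) = t * unitDist κ x y := by
  have := h.unitDist_eq (κ := κ) (Set.left_mem_Icc.mpr zero_le_one) ht
  rw [h.1, zero_sub, abs_neg, abs_of_nonneg ht.1] at this
  rw [this, mul_comm]

theorem IsGeodesic.unitDist_right {γ : ℝ → X} {x y : X} (h : IsGeodesic γ x y) {t : ℝ}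
    (ht : t ∈ Set.Icc (0 : ℝ) 1) : unitDist κ (γ t) y = (1 - t) * unitDist κ x y := by
  have := h.unitDist_eq (κ := κ) ht (Set.right_mem_Icc.mpr zero_le_one)
  rw [h.2.1, abs_sub_comm, abs_of_nonneg (sub_nonneg.mpr ht.2)] at this
  rw [this, mul_comm]

/-- Going from a point of the side to a around either end covers the whole perimeter, so the shorter
way is less than π. -/
theorem IsGeodesic.unitDist_mem_modelRange {γ : ℝ → X} {p q : X} (h : IsGeodesic γ p q) {t : ℝ}
    (ht : t ∈ Set.Icc (0 : ℝ) 1) {a : X} {s : SignType}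
    (hs : s = .pos → unitDist κ p q + unitDist κ q a + unitDist κ a p < 2 * π) :
    unitDist κ (γ t) a ∈ modelRange s := by
  refine ⟨unitDist_nonneg _ _, fun h' => ?_⟩
  have h0 := hs h'
  have h1 := unitDist_triangle (κ := κ) (γ t) q a
  have h2 := unitDist_triangle (κ := κ) (γ t) p a
  rw [unitDist_comm (γ t) p, unitDist_comm p a, h.unitDist_left ht] at h2
  rw [h.unitDist_right ht] at h1
  linarith

theorem ModelPlane.exists_lineMap (x y : ModelPlane κ) {t : ℝ} (ht : t ∈ Set.Icc (0 : ℝ) 1)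
    (h0 : 0 < unitDist κ x y) (hπ : SignType.sign κ = .pos → unitDist κ x y < π) :
    ∃ p : ModelPlane κ, ∀ z : ModelPlane κ,
      modelSin (SignType.sign κ) (unitDist κ x y) *
          modelCos (SignType.sign κ) (unitDist κ z p) =
        modelSin (SignType.sign κ) ((1 - t) * unitDist κ x y) *
            modelCos (SignType.sign κ) (unitDist κ z x) +
          modelSin (SignType.sign κ) (t * unitDist κ x y) *
            modelCos (SignType.sign κ) (unitDist κ z y) +
          modelDefect (SignType.sign κ) (unitDist κ x y) t := by
  simp only [unitDist_eq] at *
  exact UnitModelPlane.exists_lineMap x y ht h0 hπ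

theorem mul_mem_modelRange {s : SignType} {t l : ℝ} (ht : t ∈ Set.Icc (0 : ℝ) 1)
    (hl : l ∈ modelRange s) : t * l ∈ modelRange s :=
  ⟨mul_nonneg ht.1 hl.1, fun h => (mul_le_of_le_one_left hl.1 ht.2).trans (hl.2 h)⟩

theorem one_sub_mem_Icc {t : ℝ} (ht : t ∈ Set.Icc (0 : ℝ) 1) : 1 - t ∈ Set.Icc (0 : ℝ) 1 :=
  ⟨by linarith [ht.2], by linarith [ht.1]⟩

theorem modelDefect_zero_left (s : SignType) (t : ℝ) : modelDefect s 0 t = 0 := by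
  cases s <;> simp [modelDefect]

/-! ### The interpolation inequality in CAT(κ) spaces -/

/-- The interpolation inequality for the distance from a vertex to the points on the opposite side
of a geodesic triangle in a `CAT(κ)` space. -/
theorem IsCAT.modelCos_interpolate_le (hX : IsCAT κ X) {p q a : X} {γ : ℝ → X}
    (hγ : IsGeodesic γ p q) {t : ℝ} (ht : t ∈ Set.Icc (0 : ℝ) 1)
    (hs : SignType.sign κ = .pos → unitDist κ p q + unitDist κ q a + unitDist κ a p < 2 * π) :
    modelSin (SignType.sign κ) ((1 - t) * unitDist κ p q) *
          modelCos (SignType.sign κ) (unitDist κ p a) +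
        modelSin (SignType.sign κ) (t * unitDist κ p q) *
          modelCos (SignType.sign κ) (unitDist κ q a) +
        modelDefect (SignType.sign κ) (unitDist κ p q) t ≤
      modelSin (SignType.sign κ) (unitDist κ p q) *
        modelCos (SignType.sign κ) (unitDist κ (γ t) a) := by
  rcases (unitDist_nonneg (κ := κ) p q).eq_or_lt with h0 | h0
  · rw [← h0]; simp [modelSin_zero, modelDefect_zero_left]
  have t1 := unitDist_triangle (κ := κ) p a q
  have t2 := unitDist_triangle (κ := κ) q p a
  have t3 := unitDist_triangle (κ := κ) a q p
  rw [unitDist_comm p a, unitDist_comm a q] at t1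
  rw [unitDist_comm q p, unitDist_comm p a] at t2
  rw [unitDist_comm a q, unitDist_comm q p] at t3
  have hgeo : ∀ x y : X, (SignType.sign κ = .pos → unitDist κ x y < π) →
      ∃ γ : ℝ → X, IsGeodesic γ x y := fun x y h =>
    hX.exists_geodesic x y fun hκ => (div_modelScale_lt_iff hκ).mp (h (sign_eq_pos_iff.mpr hκ))
  obtain ⟨γ₁, hγ₁⟩ := hgeo q a fun h => by linarith [hs h]
  obtain ⟨γ₂, hγ₂⟩ := hgeo a p fun h => by linarith [hs h]
  obtain ⟨p', q', a', hpq, hqa, hap⟩ := UnitModelPlane.exists_triangle (SignType.sign κ)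
    (unitDist_nonneg (κ := κ) p q) (unitDist_nonneg (κ := κ) q a) (unitDist_nonneg (κ := κ) a p)
    (by linarith) (by linarith) (by linarith) hs
  change ModelPlane κ at p' q' a'
  rw [← ModelPlane.unitDist_eq] at hpq hqa hap
  have hπ : SignType.sign κ = .pos → unitDist κ p' q' < π := fun h => by linarith [hs h]
  obtain ⟨x', hx'⟩ := ModelPlane.exists_lineMap p' q' ht (hpq ▸ h0) hπ
  have hsin := modelSin_pos (hpq ▸ h0) hπ
  have hx'p : unitDist κ p' x' = t * unitDist κ p' q' := by
    refine modelCos_inj (ModelPlane.unitDist_mem_modelRange _ _)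
      (mul_mem_modelRange ht (ModelPlane.unitDist_mem_modelRange _ _))
      (mul_left_cancel₀ hsin.ne' ?_)
    rw [hx', unitDist_self, modelCos_interpolate_left]
  have hx'q : unitDist κ q' x' = (1 - t) * unitDist κ p' q' := by
    refine modelCos_inj (ModelPlane.unitDist_mem_modelRange _ _)
      (mul_mem_modelRange (one_sub_mem_Icc ht) (ModelPlane.unitDist_mem_modelRange _ _))
      (mul_left_cancel₀ hsin.ne' ?_)
    rw [hx', unitDist_self, unitDist_comm q' p', modelCos_interpolate_right]
  have hb : IsComparisonTriangle ![p, q, a] ![p', q', a'] := by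
    rw [unitDist_eq_unitDist_iff] at hpq hqa hap
    intro i j
    fin_cases i <;> fin_cases j <;>
      simp [hpq, hqa, hap, dist_comm q' p', dist_comm a' q', dist_comm p' a', dist_comm q p,
        dist_comm a q, dist_comm p a]
  have hle : dist (γ t) a ≤ dist x' a' := by
    -- The vertex a enters as the initial point of the third side: index 2, parameter 0.
    have h := hX.comparison ![p, q, a] ![γ, γ₁, γ₂]
      (by intro i; fin_cases i; exacts [hγ, hγ₁, hγ₂])
      (fun hκ => by
        have := hs (sign_eq_pos_iff.mpr hκ)
        rw [unitDist, unitDist, unitDist, ← add_div, ← add_div, div_modelScale_lt_iff hκ] at this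
        exact this) ![p', q', a'] hb 0 2 t ht 0 (Set.left_mem_Icc.mpr zero_le_one) x' a'
      ⟨(unitDist_eq_unitDist_iff (κ := κ)).mp (by
          change unitDist κ p' x' = unitDist κ p (γ t)
          rw [hx'p, hγ.unitDist_left ht, hpq]),
        (unitDist_eq_unitDist_iff (κ := κ)).mp (by
          change unitDist κ x' q' = unitDist κ (γ t) q
          rw [unitDist_comm, hx'q, hγ.unitDist_right ht, hpq])⟩
      ⟨by
        change dist a' a' = dist a (γ₂ 0)
        rw [hγ₂.1, dist_self, dist_self],
       by
        change dist a' p' = dist (γ₂ 0) p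
        rw [hγ₂.1]; exact hb 2 0⟩
    change dist (γ t) (γ₂ 0) ≤ _ at h
    rwa [hγ₂.1] at h
  have hC := (modelCos_le_iff (ModelPlane.unitDist_mem_modelRange x' a')
    (hγ.unitDist_mem_modelRange ht hs)).mpr ((unitDist_le_unitDist_iff (κ := κ)).mpr hle)
  refine le_trans (le_of_eq ?_) (mul_le_mul_of_nonneg_left hC (hpq ▸ hsin.le))
  have := hx' a'
  rw [hpq, hap, unitDist_comm a' q', hqa, unitDist_comm a' x'] at this
  rw [this, unitDist_comm p a]

end unitDist

/-! ### Continuous dependence of geodesics on their end -/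

section CAT

variable {κ : ℝ} {X : Type*} [MetricSpace X]

theorem unitDist_mul_modelScale (x y : X) : unitDist κ x y * modelScale κ = dist x y :=
  div_mul_cancel₀ _ (modelScale_pos κ).ne'

/-- In a `CAT(κ)` space, short geodesics from a fixed point depend continuously on their end. -/
theorem IsCAT.continuous_geodesic (hX : IsCAT κ X) {T : Type*} [TopologicalSpace T] {q : X}
    {p : T → X} (hp : Continuous p) {σ : T → ℝ → X} (hσ : ∀ s, IsGeodesic (σ s) q (p s))
    (hπ : ∀ s, SignType.sign κ = .pos → unitDist κ q (p s) < π)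
    {τ : T → ℝ} (hτ : Continuous τ) (hτ' : ∀ s, τ s ∈ Set.Icc (0 : ℝ) 1) :
    Continuous fun s => σ s (τ s) := by
  rw [continuous_iff_continuousAt]
  intro s₀
  have hl : Continuous fun s => unitDist κ q (p s) :=
    continuous_unitDist.comp (continuous_const.prodMk hp)
  set y₀ := σ s₀ (τ s₀) with hy₀
  suffices h : Tendsto (fun s => unitDist κ (σ s (τ s)) y₀) (𝓝 s₀) (𝓝 0) by
    rw [ContinuousAt, tendsto_iff_dist_tendsto_zero]
    simpa [unitDist_mul_modelScale] using h.mul_const (modelScale κ)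
  have hqy : unitDist κ q y₀ = τ s₀ * unitDist κ q (p s₀) := (hσ s₀).unitDist_left (hτ' s₀)
  have hpy : unitDist κ (p s₀) y₀ = (1 - τ s₀) * unitDist κ q (p s₀) := by
    rw [unitDist_comm, (hσ s₀).unitDist_right (hτ' s₀)]
  rcases (unitDist_nonneg (κ := κ) q (p s₀)).eq_or_lt with h0 | h0
  · have hq : q = y₀ := eq_of_unitDist_eq_zero (κ := κ) (by rw [hqy, ← h0, mul_zero])
    have h : Tendsto (fun s => τ s * unitDist κ q (p s)) (𝓝 s₀) (𝓝 0) :=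
      (hτ.mul hl).tendsto' s₀ _ (by simp [← h0])
    refine h.congr fun s => ?_
    rw [← hq, unitDist_comm (σ s (τ s)), (hσ s).unitDist_left (hτ' s)]
  have hpy' : Continuous fun s => unitDist κ (p s) y₀ :=
    continuous_unitDist.comp (hp.prodMk continuous_const)
  -- `f s` is the lower bound that the interpolation inequality gives in the triangle q, `p s`,
  -- `y₀`. It is continuous and equals the value for distance zero at `s₀`, so the distance to `y₀`
  -- must become small.
  set f : T → ℝ := fun s =>
    modelSin (SignType.sign κ) ((1 - τ s) * unitDist κ q (p s)) *
          modelCos (SignType.sign κ) (unitDist κ q y₀) +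
        modelSin (SignType.sign κ) (τ s * unitDist κ q (p s)) *
          modelCos (SignType.sign κ) (unitDist κ (p s) y₀) +
        modelDefect (SignType.sign κ) (unitDist κ q (p s)) (τ s) with hf
  have hfc : Continuous f :=
    ((((continuous_modelSin _).comp ((continuous_const.sub hτ).mul hl)).mul
      continuous_const).add (((continuous_modelSin _).comp (hτ.mul hl)).mul
        ((continuous_modelCos _).comp hpy'))).add
      ((continuous_modelDefect _).comp (hl.prodMk hτ))
  have hf0 : f s₀ = modelSin (SignType.sign κ) (unitDist κ q (p s₀)) *
      modelCos (SignType.sign κ) 0 := by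
    simp only [hf]
    rw [hqy, hpy, modelCos_interpolate_self]
  rw [Metric.tendsto_nhds]
  intro ε hε
  -- Cutting ε down to 1 keeps it in the range where `modelCos` is decreasing.
  have hε' : 0 < min ε 1 := lt_min hε one_pos
  have hεr : min ε 1 ∈ modelRange (SignType.sign κ) :=
    ⟨hε'.le, fun _ => (min_le_right _ _).trans (by linarith [Real.pi_gt_three])⟩
  have h0r : (0 : ℝ) ∈ modelRange (SignType.sign κ) := ⟨le_rfl, fun _ => Real.pi_pos.le⟩
  have hsin := modelSin_pos h0 (hπ s₀)
  have e1 : ∀ᶠ s in 𝓝 s₀, modelSin (SignType.sign κ) (unitDist κ q (p s)) *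
      modelCos (SignType.sign κ) (min ε 1) < f s := by
    refine ((((continuous_modelSin _).comp hl).mul continuous_const).tendsto s₀).eventually_lt
      (hfc.tendsto s₀) ?_
    rw [hf0]
    exact mul_lt_mul_of_pos_left (modelCos_strictAntiOn _ h0r hεr hε') hsin
  have e2 : ∀ᶠ s in 𝓝 s₀, 0 < modelSin (SignType.sign κ) (unitDist κ q (p s)) :=
    (((continuous_modelSin _).comp hl).tendsto s₀).eventually_const_lt hsin
  -- At `s₀` the triangle is degenerate, with perimeter twice a length below π; the bound persists
  -- nearby.
  have e3 : ∀ᶠ s in 𝓝 s₀, SignType.sign κ = .pos →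
      unitDist κ q (p s) + unitDist κ (p s) y₀ + unitDist κ y₀ q < 2 * π := by
    by_cases hκ : SignType.sign κ = .pos
    · refine (((hl.add hpy').add continuous_const).tendsto s₀).eventually_lt_const ?_ |>.mono
        fun s h _ => h
      change unitDist κ q (p s₀) + unitDist κ (p s₀) y₀ + unitDist κ y₀ q < 2 * π
      rw [unitDist_comm y₀ q, hqy, hpy]
      linarith [hπ s₀ hκ]
    · exact .of_forall fun s h => absurd h hκ
  filter_upwards [e1, e2, e3] with s h1 h2 h3
  have h4 := h1.trans_le (hX.modelCos_interpolate_le (hσ s) (hτ' s) h3)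
  have h5 := lt_of_mul_lt_mul_left h4 h2.le
  rw [(modelCos_strictAntiOn _).lt_iff_gt hεr ((hσ s).unitDist_mem_modelRange (hτ' s) h3)] at h5
  rw [Real.dist_eq, sub_zero, abs_of_nonneg (unitDist_nonneg _ _)]
  exact h5.trans_le (min_le_left _ _)

theorem IsGeodesic.continuousOn {γ : ℝ → X} {x y : X} (h : IsGeodesic γ x y) :
    ContinuousOn γ (Set.Icc 0 1) := by
  refine (LipschitzOnWith.of_dist_le_mul (K := ⟨dist x y, dist_nonneg⟩) fun s hs t ht => ?_)
    |>.continuousOn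
  rw [h.2.2 s hs t ht, Real.dist_eq]
  rfl

/-! ### The covering estimate -/

/-- The real arithmetic of the covering estimate. In the application A, B, N belong to the side from
`a 0` to `a 1`, and A', B', N' to the geodesic from `a 2` to its point p. The pairs x, c, p, q
(index 0 or 1) are `modelCos` of the distances to `a 0` and `a 1` from y, `a 2` and p, and to `b 0`
and `b 1` from o; the plain c is the value at R. Averaging `hy0` and `hy1` with weights A, B and
inserting the side formulas gives `i6`, against `hc0` and `hc1`. -/
theorem false_of_interpolations {N N' A B A' B' e e' x₀ x₁ c p₀ p₁ c₀ c₁ CL CLR C0 Co q₀ q₁ : ℝ}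
    (hN : 0 < N) (hN' : 0 < N') (hA : 0 ≤ A) (hB : 0 ≤ B) (hAB : 0 < A + B)
    (hy0 : A' * c₀ + B' * p₀ + e' ≤ N' * x₀) (hy1 : A' * c₁ + B' * p₁ + e' ≤ N' * x₁)
    (hside : A * p₀ + B * p₁ + e = N * C0) (hm2 : N * CL = A * c₀ + B * c₁ + e)
    (hmo : N * Co = A * q₀ + B * q₁ + e) (hsub : N' * CLR ≤ A' * CL + B' * C0 + e')
    (hCo : Co ≤ CLR) (hdef : (A + B) * e' = N * e') (hdef' : (A' + B') * e = N' * e)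
    (h0 : c ≤ q₀) (h1 : c ≤ q₁) (hc0 : x₀ < c) (hc1 : x₁ < c) : False := by
  have i1 := mul_le_mul_of_nonneg_left hy0 hA
  have i2 := mul_le_mul_of_nonneg_left hy1 hB
  have i3 := mul_le_mul_of_nonneg_left hsub hN.le
  have i4 := mul_le_mul_of_nonneg_left hCo (mul_pos hN hN').le
  have i5 : N' * (A * q₀ + B * q₁) ≤ N' * (A * x₀ + B * x₁) := by
    have j1 : A' * (A * c₀ + B * c₁) + B' * (A * p₀ + B * p₁) + (A + B) * e' =
        N * (A' * CL + B' * C0 + e') - N' * e := by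
      linear_combination -A' * hm2 + B' * hside + hdef - hdef'
    have j2 : N' * (A * q₀ + B * q₁) = N * N' * Co - N' * e := by
      linear_combination -N' * hmo
    linarith
  have i6 := le_of_mul_le_mul_left i5 hN'
  have i7 := mul_le_mul_of_nonneg_left h0 hA
  have i8 := mul_le_mul_of_nonneg_left h1 hB
  rcases hA.eq_or_lt with h | h
  · rw [← h, zero_add] at hAB
    have := mul_lt_mul_of_pos_left hc1 hAB
    rw [← h] at i6
    linarith
  · have := mul_lt_mul_of_pos_left hc0 h
    have := mul_le_mul_of_nonneg_left hc1.le hB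
    linarith

/-- A point on a geodesic from `a 2` to the side opposite to it, at distance `R` from `a 2`, is at
distance at most `R` from `a 0` or from `a 1`, provided that a comparison triangle lies in a ball
of radius `R`. -/
theorem IsCAT.unitDist_le_or_unitDist_le (hX : IsCAT κ X) {a : Fin 3 → X} {b : Fin 3 → ModelPlane κ}
    (hs : SignType.sign κ = .pos →
      unitDist κ (a 0) (a 1) + unitDist κ (a 1) (a 2) + unitDist κ (a 2) (a 0) < 2 * π)
    (hb : IsComparisonTriangle a b) {o : ModelPlane κ} {R : ℝ}
    (hR : R ∈ modelRange (SignType.sign κ)) (ho : ∀ i, unitDist κ o (b i) ≤ R)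
    (h01 : 0 < unitDist κ (a 0) (a 1)) {γ σ : ℝ → X} {r t : ℝ} (hγ : IsGeodesic γ (a 0) (a 1))
    (hr : r ∈ Set.Icc (0 : ℝ) 1) (hσ : IsGeodesic σ (a 2) (γ r)) (ht : t ∈ Set.Icc (0 : ℝ) 1)
    (htR : t * unitDist κ (a 2) (γ r) = R) (hpos : 0 < unitDist κ (a 2) (γ r)) :
    unitDist κ (σ t) (a 0) ≤ R ∨ unitDist κ (σ t) (a 1) ≤ R := by
  have hab : ∀ i j, unitDist κ (b i) (b j) = unitDist κ (a i) (a j) := fun i j =>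
    unitDist_eq_unitDist_iff.mpr (hb i j)
  have t01 := unitDist_triangle (κ := κ) (a 0) (a 2) (a 1)
  rw [unitDist_comm (a 0) (a 2), unitDist_comm (a 2) (a 1)] at t01
  have hπ01 : SignType.sign κ = .pos → unitDist κ (a 0) (a 1) < π := fun h => by linarith [hs h]
  obtain ⟨p', hp'⟩ := ModelPlane.exists_lineMap (b 0) (b 1) hr (hab 0 1 ▸ h01) (hab 0 1 ▸ hπ01)
  rw [hab] at hp'
  have hp0 := hγ.unitDist_left (κ := κ) hr
  have hp1 := hγ.unitDist_right (κ := κ) hr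
  -- Cutting the triangle along a segment from `a 2` does not increase the perimeter, so both pieces
  -- remain small.
  have hs0 : SignType.sign κ = .pos →
      unitDist κ (a 2) (γ r) + unitDist κ (γ r) (a 0) + unitDist κ (a 0) (a 2) < 2 * π := by
    intro h
    have h1 := unitDist_triangle (κ := κ) (a 2) (a 1) (γ r)
    rw [unitDist_comm (a 1) (γ r), unitDist_comm (a 2) (a 1)] at h1
    rw [unitDist_comm (γ r) (a 0), unitDist_comm (a 0) (a 2)]
    linarith [hs h]
  have hs1 : SignType.sign κ = .pos →
      unitDist κ (a 2) (γ r) + unitDist κ (γ r) (a 1) + unitDist κ (a 1) (a 2) < 2 * π := by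
    intro h
    have h1 := unitDist_triangle (κ := κ) (a 2) (a 0) (γ r)
    linarith [hs h]
  have hπ' : SignType.sign κ = .pos → unitDist κ (a 2) (γ r) < π := by
    intro h
    have h1 := unitDist_triangle (κ := κ) (a 2) (a 0) (γ r)
    rw [unitDist_comm (a 2) (a 0), unitDist_comm (a 0) (γ r)] at h1
    linarith [hs0 h]
  have hN := modelSin_pos h01 hπ01
  have hN' := modelSin_pos hpos hπ'
  have hA := modelSin_nonneg (mul_mem_modelRange (one_sub_mem_Icc hr)
    ⟨h01.le, fun h => (hπ01 h).le⟩)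
  have hB := modelSin_nonneg (mul_mem_modelRange hr ⟨h01.le, fun h => (hπ01 h).le⟩)
  have hside : modelSin (SignType.sign κ) ((1 - r) * unitDist κ (a 0) (a 1)) *
        modelCos (SignType.sign κ) (unitDist κ (γ r) (a 0)) +
      modelSin (SignType.sign κ) (r * unitDist κ (a 0) (a 1)) *
        modelCos (SignType.sign κ) (unitDist κ (γ r) (a 1)) +
      modelDefect (SignType.sign κ) (unitDist κ (a 0) (a 1)) r =
      modelSin (SignType.sign κ) (unitDist κ (a 0) (a 1)) * modelCos (SignType.sign κ) 0 := by
    rw [unitDist_comm (γ r) (a 0), hp0, hp1, modelCos_interpolate_self]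
  have hy0 := hX.modelCos_interpolate_le hσ ht hs0
  have hy1 := hX.modelCos_interpolate_le hσ ht hs1
  have hp2 := hX.modelCos_interpolate_le hγ hr hs
  have hm2 := hp' (b 2)
  have hmo := hp' o
  rw [hab, hab] at hm2
  have hdef := modelDefect_mul (SignType.sign κ) (unitDist κ (a 0) (a 1)) r
    (unitDist κ (a 2) (γ r)) t
  have hdef' := modelDefect_mul (SignType.sign κ) (unitDist κ (a 2) (γ r)) t
    (unitDist κ (a 0) (a 1)) r
  have hsub := modelCos_sub_le (SignType.sign κ) (t := t) (L := unitDist κ (b 2) p')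
    (mul_mem_modelRange ht ⟨hpos.le, fun h => (hπ' h).le⟩)
  have hrange : unitDist κ (γ r) (a 2) ∈ modelRange (SignType.sign κ) :=
    hγ.unitDist_mem_modelRange hr hs
  -- Both distances have the same interpolation data: an equality in the model plane, an inequality
  -- in X.
  have hL : unitDist κ (a 2) (γ r) ≤ unitDist κ (b 2) p' := by
    rw [unitDist_comm (a 2)]
    refine (modelCos_le_iff (ModelPlane.unitDist_mem_modelRange _ _) hrange).mp
      (le_of_mul_le_mul_left ?_ hN)
    rw [hm2]
    rw [unitDist_comm (a 2) (a 0), unitDist_comm (a 2) (a 1)]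
    exact hp2
  have hoL : unitDist κ (b 2) p' - t * unitDist κ (a 2) (γ r) ≤ unitDist κ o p' := by
    have h1 := unitDist_triangle (κ := κ) (b 2) o p'
    rw [unitDist_comm (b 2) o] at h1
    linarith [ho 2]
  have hL0 : 0 ≤ unitDist κ (b 2) p' - t * unitDist κ (a 2) (γ r) := by
    have := mul_le_of_le_one_left hpos.le ht.2
    linarith
  have hCo := (modelCos_le_iff (ModelPlane.unitDist_mem_modelRange o p')
    (y := unitDist κ (b 2) p' - t * unitDist κ (a 2) (γ r))
    ⟨hL0, fun h => hoL.trans ((ModelPlane.unitDist_mem_modelRange o p').2 h)⟩).mpr hoL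
  have ho0 := (modelCos_le_iff hR (ModelPlane.unitDist_mem_modelRange o (b 0))).mpr (ho 0)
  have ho1 := (modelCos_le_iff hR (ModelPlane.unitDist_mem_modelRange o (b 1))).mpr (ho 1)
  by_contra! hcon
  have hc0 := modelCos_strictAntiOn _ hR (hσ.unitDist_mem_modelRange ht hs0) hcon.1
  have hc1 := modelCos_strictAntiOn _ hR (hσ.unitDist_mem_modelRange ht hs1) hcon.2
  have hAB : 0 < modelSin (SignType.sign κ) ((1 - r) * unitDist κ (a 0) (a 1)) +
      modelSin (SignType.sign κ) (r * unitDist κ (a 0) (a 1)) := by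
    rcases hr.1.eq_or_lt with h | h
    · rw [← h]; simpa [modelSin_zero] using hN
    · refine add_pos_of_nonneg_of_pos hA (modelSin_pos (mul_pos h h01) fun h' => ?_)
      exact (mul_le_of_le_one_left h01.le hr.2).trans_lt (hπ01 h')
  exact false_of_interpolations hN hN' hA hB hAB hy0 hy1 hside hm2 hmo hsub hCo hdef hdef' ho0 ho1
    hc0 hc1

/-! ### The common centre by connectedness -/

/-- A triangle in a `CAT(κ)` space is contained in a closed ball whose radius is that of any closed
ball containing a comparison triangle. -/
theorem IsCAT.exists_forall_unitDist_le (hX : IsCAT κ X) {a : Fin 3 → X} {b : Fin 3 → ModelPlane κ}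
    (hs : SignType.sign κ = .pos →
      unitDist κ (a 0) (a 1) + unitDist κ (a 1) (a 2) + unitDist κ (a 2) (a 0) < 2 * π)
    (hb : IsComparisonTriangle a b) {o : ModelPlane κ} {R : ℝ}
    (hR : R ∈ modelRange (SignType.sign κ)) (ho : ∀ i, unitDist κ o (b i) ≤ R) :
    ∃ y : X, ∀ i, unitDist κ y (a i) ≤ R := by
  have hdiam : ∀ i j, unitDist κ (a i) (a j) ≤ 2 * R := fun i j => by
    have h := unitDist_triangle (κ := κ) (b i) o (b j)
    rw [unitDist_eq_unitDist_iff.mpr (hb i j), unitDist_comm (b i) o] at h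
    linarith [ho i, ho j]
  rcases hR.1.eq_or_lt with hR0 | hR0
  · exact ⟨a 0, fun i => by simpa [← hR0] using hdiam 0 i⟩
  have t01 := unitDist_triangle (κ := κ) (a 0) (a 2) (a 1)
  rw [unitDist_comm (a 0) (a 2), unitDist_comm (a 2) (a 1)] at t01
  have hgeo : ∀ x y : X, (SignType.sign κ = .pos → unitDist κ x y < π) →
      ∃ γ : ℝ → X, IsGeodesic γ x y := fun x y h =>
    hX.exists_geodesic x y fun hκ => (div_modelScale_lt_iff hκ).mp (h (sign_eq_pos_iff.mpr hκ))
  obtain ⟨γ, hγ⟩ := hgeo (a 0) (a 1) fun h => by linarith [hs h]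
  have hπ : ∀ s : Set.Icc (0 : ℝ) 1, SignType.sign κ = .pos → unitDist κ (a 2) (γ s) < π := by
    intro s h
    have h1 := unitDist_triangle (κ := κ) (a 2) (a 0) (γ s)
    have h2 := unitDist_triangle (κ := κ) (a 2) (a 1) (γ s)
    rw [unitDist_comm (a 1) (γ s), hγ.unitDist_right s.2,
      unitDist_comm (a 2) (a 1)] at h2
    rw [hγ.unitDist_left s.2] at h1
    linarith [hs h]
  choose σ hσ using fun s : Set.Icc (0 : ℝ) 1 => hgeo (a 2) (γ s) (hπ s)
  have hγc : Continuous fun s : Set.Icc (0 : ℝ) 1 => γ s :=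
    continuousOn_iff_continuous_domRestrict.mp hγ.continuousOn
  -- With this parameter `σ s` has run the length min(R, d(a₂, γ s)), so the stopping rule is one
  -- continuous formula.
  set τ : Set.Icc (0 : ℝ) 1 → ℝ := fun s => R / max R (unitDist κ (a 2) (γ s)) with hτdef
  have hmax : ∀ s : Set.Icc (0 : ℝ) 1, 0 < max R (unitDist κ (a 2) (γ s)) := fun s =>
    hR0.trans_le (le_max_left _ _)
  have hτc : Continuous τ :=
    continuous_const.div (continuous_const.max
      (continuous_unitDist.comp (continuous_const.prodMk hγc))) fun s => (hmax s).ne'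
  have hτ : ∀ s, τ s ∈ Set.Icc (0 : ℝ) 1 := fun s =>
    ⟨div_nonneg hR0.le (hmax s).le, (div_le_one (hmax s)).mpr (le_max_left _ _)⟩
  have hyc := hX.continuous_geodesic hγc hσ hπ hτc hτ
  set y : Set.Icc (0 : ℝ) 1 → X := fun s => σ s (τ s) with hy
  have hτ1 : ∀ s : Set.Icc (0 : ℝ) 1, unitDist κ (a 2) (γ s) ≤ R → y s = γ s := fun s h => by
    have : τ s = 1 := by simp only [hτdef]; rw [max_eq_left h, div_self hR0.ne']
    simp only [hy]
    rw [this, (hσ s).2.1]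
  have hτ2 : ∀ s : Set.Icc (0 : ℝ) 1, R ≤ unitDist κ (a 2) (γ s) →
      τ s * unitDist κ (a 2) (γ s) = R := fun s h => by
    simp only [hτdef]
    rw [max_eq_right h, div_mul_cancel₀ _ (hR0.trans_le h).ne']
  have hy2 : ∀ s, unitDist κ (y s) (a 2) ≤ R := fun s => by
    rcases le_total (unitDist κ (a 2) (γ s)) R with h | h
    · rw [hτ1 s h, unitDist_comm]; exact h
    · rw [unitDist_comm, (hσ s).unitDist_left (hτ s), hτ2 s h]
  have hend : ∀ s : Set.Icc (0 : ℝ) 1, unitDist κ (a 2) (γ s) ≤ 2 * R →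
      unitDist κ (y s) (γ s) ≤ R := fun s h => by
    rcases le_total (unitDist κ (a 2) (γ s)) R with h' | h'
    · rw [hτ1 s h', unitDist_self]; exact hR0.le
    · rw [(hσ s).unitDist_right (hτ s), sub_mul, hτ2 s h']; linarith
  have hy0 : unitDist κ (y 0) (a 0) ≤ R := by
    have := hend 0
    rw [Set.Icc.coe_zero, hγ.1] at this
    exact this (hdiam 2 0)
  have hy1 : unitDist κ (y 1) (a 1) ≤ R := by
    have := hend 1
    rw [Set.Icc.coe_one, hγ.2.1] at this
    exact this (hdiam 2 1)
  have key : ∃ s, unitDist κ (y s) (a 0) ≤ R ∧ unitDist κ (y s) (a 1) ≤ R := by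
    rcases (unitDist_nonneg (κ := κ) (a 0) (a 1)).eq_or_lt with h01 | h01
    · refine ⟨0, hy0, ?_⟩
      rwa [← eq_of_unitDist_eq_zero h01.symm]
    have hcl : ∀ i, IsClosed {s | unitDist κ (y s) (a i) ≤ R} := fun i =>
      isClosed_le (continuous_unitDist.comp (hyc.prodMk continuous_const)) continuous_const
    have hcov : ∀ s, unitDist κ (y s) (a 0) ≤ R ∨ unitDist κ (y s) (a 1) ≤ R := fun s => by
      rcases le_total (unitDist κ (a 2) (γ s)) R with h | h
      -- Here the curve lies on the side, whose length is at most 2R, so one end is within R.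
      · rw [hτ1 s h, unitDist_comm, hγ.unitDist_left s.2, hγ.unitDist_right s.2]
        by_contra! hcon
        linarith [hdiam 0 1]
      · exact hX.unitDist_le_or_unitDist_le hs hb hR ho h01 hγ s.2 (hσ s) (hτ s) (hτ2 s h)
          (hR0.trans_le h)
    obtain ⟨s, -, h⟩ := isPreconnected_closed_iff.mp
      (isPreconnected_univ (α := Set.Icc (0 : ℝ) 1)) _ _ (hcl 0) (hcl 1) (fun s _ => hcov s)
      ⟨0, trivial, hy0⟩ ⟨1, trivial, hy1⟩
    exact ⟨s, h⟩
  obtain ⟨s, h0, h1⟩ := key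
  exact ⟨y s, fun i => by fin_cases i; exacts [h0, h1, hy2 s]⟩

end CAT

theorem mainTheorem4 (κ : ℝ) (X : Type*) [MetricSpace X] (hX : IsCAT κ X) : CurvLE X κ := by
  intro a ha b hb
  have : Nonempty (ModelPlane κ) := ⟨b 0⟩
  refine le_ciInf fun o => ?_
  set r : ℝ := max (dist o (b 0)) (max (dist o (b 1)) (dist o (b 2))) with hr
  have hri : ∀ i, dist o (b i) ≤ r := fun i => by
    fin_cases i <;> simp [hr]
  -- The maximum is itself a distance in the model plane, hence at most π in the spherical case.
  have hmem : r / modelScale κ ∈ modelRange (SignType.sign κ) := by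
    have : ∃ i, r = dist o (b i) := by
      rcases max_choice (dist o (b 0)) (max (dist o (b 1)) (dist o (b 2))) with h | h
      · exact ⟨0, h⟩
      · rcases max_choice (dist o (b 1)) (dist o (b 2)) with h' | h'
        · exact ⟨1, h.trans h'⟩
        · exact ⟨2, h.trans h'⟩
    obtain ⟨i, hi⟩ := this
    rw [hi]
    exact ModelPlane.unitDist_mem_modelRange o (b i)
  obtain ⟨y, hy⟩ := hX.exists_forall_unitDist_le
    (fun h => by
      have hκ := sign_eq_pos_iff.mp h
      rw [unitDist, unitDist, unitDist, ← add_div, ← add_div, div_modelScale_lt_iff hκ]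
      exact ha hκ) hb hmem
    fun i => div_le_div_of_nonneg_right (hri i) (modelScale_pos κ).le
  have hy' : ∀ i, dist y (a i) ≤ r := fun i =>
    (div_le_div_iff_of_pos_right (modelScale_pos κ)).mp (hy i)
  exact (ciInf_le ⟨0, Set.forall_mem_range.mpr fun x => le_max_of_le_left dist_nonneg⟩ y).trans
    (max_le (hy' 0) (max_le (hy' 1) (hy' 2)))

end
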